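/- **($t$-Copy Simultaneous Haar Indistinguishability.)** Let $\mathscr H_d$ denote the Haar (uniform) probability distribution on the unit vectors of $\mathbb C^d$, and let $\mathscr H_d^t$ be the distribution that samples $|\psi\rangle\leftarrow\mathscr H_d$ and outputs $|\psi\rangle^{\otimes t}$. A *non-local adversary* $\mathcal A=(\mathcal B,\mathcal C,\rho_{BC})$ consists of a quantum state $\rho_{BC}$ (a density matrix, possibly entangled) on two registers $B,C$ of arbitrary finite dimension, a two-outcome measurement (POVM) $\{M_0,M_1\}$ that Bob applies to register $B$ together with his half of the challenge, and a two-outcome measurement $\{N_0,N_1\}$ that Charlie applies to register $C$ together with his half. On a challenge $|\Psi\rangle$ in $X\otimes Y$ it outputs the bits $(b_1,b_2)$ with probability $\Pr[(b_1,b_2)\leftarrow\mathcal A(\Psi)]=\operatorname{Tr}\big((M_{b_1}\otimes N_{b_2})(\rho_{BC}\otimes|\Psi\rangle\langle\Psi|_{XY})\big)$, where $M_{b_1}$ acts on $BX$ and $N_{b_2}$ on $CY$. For a distribution $\mathcal D$ over pure states we say that $(\varepsilon,\mathcal D)$-*simultaneous state indistinguishability* (SSI) holds if for every non-local adversary $\mathcal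 A$ and every pair of bits $b_1,b_2$, $$\Big|\Pr_{|\psi\rangle\leftarrow\mathcal D}\big[(b_1,b_2)\leftarrow\mathcal A(\psi\otimes\psi)\big]-\Pr_{|\psi\rangle,|\psi'\rangle\leftarrow\mathcal D\text{ independent}}\big[(b_1,b_2)\leftarrow\mathcal A(\psi\otimes\psi')\big]\Big|\le\varepsilon .$$ Then: 1. There is an absolute constant $K>0$ such that for all integers $n,t\ge 0$, with $d=2^n$, $\big(K\,t^2/\sqrt d,\ \mathscr H_{d}^{t}\big)$-SSI holds. 2. In particular, if $\varepsilon(n)\to 0$ as $n\to\infty$ and $t(n)=\varepsilon(n)\,2^{n/4}$ is a non-negative integer for every $n$, then there is a function $\delta(n)=O(\varepsilon(n)^2)$ such that $(\delta(n),\mathscr H_{2^n}^{t(n)})$-SSI holds for every $n$. -/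

import Mathlib

open scoped Matrix Kronecker ComplexOrder
open MeasureTheory

namespace SSI

/-- Pure states on the register with computational basis `ι`: the unit vectors of `ℂ^ι`. -/
abbrev PureState (ι : Type*) [Fintype ι] : Type _ :=
  Metric.sphere (0 : EuclideanSpace ℂ ι) 1

section Tensor

variable {X Y ι : Type*} [Fintype X] [Fintype Y] [Fintype ι]

theorem sum_normSq (ψ : PureState X) : ∑ i, ‖ψ.1 i‖ ^ 2 = 1 := by
  have h : ‖ψ.1‖ = 1 := mem_sphere_zero_iff_norm.mp ψ.2
  rw [← EuclideanSpace.norm_sq_eq, h, one_pow]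

theorem mem_sphere_of_sum (v : EuclideanSpace ℂ X) (h : ∑ i, ‖v i‖ ^ 2 = 1) :
    v ∈ Metric.sphere (0 : EuclideanSpace ℂ X) 1 := by
  rw [mem_sphere_zero_iff_norm, EuclideanSpace.norm_eq, h, Real.sqrt_one]

/-- The product state `|ψ⟩ ⊗ |φ⟩` of the joint register. -/
noncomputable def tensor (ψ : PureState X) (φ : PureState Y) : PureState (X × Y) :=
  ⟨WithLp.toLp 2 fun p => ψ.1 p.1 * φ.1 p.2, mem_sphere_of_sum _ (by
    simp only [norm_mul, mul_pow]
    rw [Fintype.sum_prod_type]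
    simp only [← Finset.mul_sum, sum_normSq, mul_one])⟩

/-- The state `|ψ⟩^{⊗ t}`, on `t` copies of the register. -/
noncomputable def tensorPower (t : ℕ) (ψ : PureState ι) : PureState (Fin t → ι) :=
  ⟨WithLp.toLp 2 fun x => ∏ k, ψ.1 (x k), mem_sphere_of_sum _ (by
    classical
    simp only [norm_prod, ← Finset.prod_pow]
    rw [← Fintype.sum_pow (fun i => ‖ψ.1 i‖ ^ 2) t, sum_normSq, one_pow])⟩

/-- The density matrix `|ψ⟩⟨ψ|`. -/
def densityMatrix (ψ : PureState X) : Matrix X X ℂ :=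
  Matrix.vecMulVec (fun i => ψ.1 i) (fun i => star (ψ.1 i))

theorem measurable_tensor :
    Measurable fun p : PureState X × PureState Y => tensor p.1 p.2 := by
  refine Continuous.measurable (Continuous.subtype_mk ?_ _)
  refine (PiLp.continuous_toLp 2 _).comp (continuous_pi fun q => ?_)
  fun_prop

theorem measurable_tensorPower (t : ℕ) :
    Measurable (tensorPower t : PureState ι → PureState (Fin t → ι)) := by
  refine Continuous.measurable (Continuous.subtype_mk ?_ _)
  refine (PiLp.continuous_toLp 2 _).comp (continuous_pi fun q => ?_)
  fun_prop

end Tensor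

/-- A non-local adversary with private registers `B` (Bob) and `C` (Charlie), who receive the
challenge registers `X` and `Y` respectively. They share an arbitrary (possibly entangled, possibly
mixed) state on `B ⊗ C`. Bob produces his bit by a two-outcome measurement (POVM) of the registers
`B, X`, and Charlie his by a two-outcome measurement of `C, Y`. -/
structure NonlocalAdversary (B C X Y : Type*) [Fintype B] [Fintype C] [Fintype X] [Fintype Y]
    [DecidableEq B] [DecidableEq C] [DecidableEq X] [DecidableEq Y] where
  /-- the shared state -/
  shared : Matrix (B × C) (B × C) ℂ
  shared_posSemidef : shared.PosSemidef
  shared_trace : shared.trace = 1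
  /-- Bob's measurement -/
  bob : Bool → Matrix (B × X) (B × X) ℂ
  bob_posSemidef : ∀ b, (bob b).PosSemidef
  bob_sum : ∑ b, bob b = 1
  /-- Charlie's measurement -/
  charlie : Bool → Matrix (C × Y) (C × Y) ℂ
  charlie_posSemidef : ∀ c, (charlie c).PosSemidef
  charlie_sum : ∑ c, charlie c = 1

section Adversary

variable {B C X Y : Type*} [Fintype B] [Fintype C] [Fintype X] [Fintype Y]
  [DecidableEq B] [DecidableEq C] [DecidableEq X] [DecidableEq Y]

/-- The global state `ρ_{BC} ⊗ ψ_{XY}`, with the registers regrouped as `(B, X), (C, Y)`. -/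
def NonlocalAdversary.globalState (A : NonlocalAdversary B C X Y) (ψ : PureState (X × Y)) :
    Matrix ((B × X) × (C × Y)) ((B × X) × (C × Y)) ℂ :=
  Matrix.reindex (Equiv.prodProdProdComm B C X Y) (Equiv.prodProdProdComm B C X Y)
    (A.shared ⊗ₖ densityMatrix ψ)

/-- The probability that Bob outputs `b₁` and Charlie outputs `b₂` on the challenge `ψ`. -/
noncomputable def NonlocalAdversary.outputProb (A : NonlocalAdversary B C X Y)
    (ψ : PureState (X × Y)) (b₁ b₂ : Bool) : ℝ :=
  (((A.bob b₁ ⊗ₖ A.charlie b₂) * A.globalState ψ).trace).re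

/-- `ε`-simultaneous state indistinguishability of two distributions over bipartite pure states
against a given non-local adversary. -/
def IndistinguishableAgainst (ε : ℝ) (D₁ D₂ : Measure (PureState (X × Y)))
    (A : NonlocalAdversary B C X Y) : Prop :=
  ∀ b₁ b₂ : Bool, |∫ ψ, A.outputProb ψ b₁ b₂ ∂D₁ - ∫ ψ, A.outputProb ψ b₁ b₂ ∂D₂| ≤ ε

end Adversary

section Distributions

variable {ι : Type*} [Fintype ι]

/-- `D^id`: sample `|ψ⟩ ← D`, output `|ψ⟩ ⊗ |ψ⟩`. -/
noncomputable def identical (D : Measure (PureState ι)) : Measure (PureState (ι × ι)) :=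
  D.map fun ψ => tensor ψ ψ

/-- `D^ind`: sample `|ψ⟩, |ψ'⟩ ← D` independently, output `|ψ⟩ ⊗ |ψ'⟩`. -/
noncomputable def independent (D : Measure (PureState ι)) : Measure (PureState (ι × ι)) :=
  (D.prod D).map fun p => tensor p.1 p.2

/-- `D^t`: sample `|ψ⟩ ← D`, output `|ψ⟩^{⊗ t}`. -/
noncomputable def copies (t : ℕ) (D : Measure (PureState ι)) : Measure (PureState (Fin t → ι)) :=
  D.map (tensorPower t)

/-- `(ε, D)`-simultaneous state indistinguishability: `D^id` and `D^ind` are `ε`-indistinguishable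
against all non-local adversaries, with private registers of arbitrary (finite) dimension. -/
def HoldsSSI [DecidableEq ι] (ε : ℝ) (D : Measure (PureState ι)) : Prop :=
  ∀ (B C : Type) [Fintype B] [Fintype C] [DecidableEq B] [DecidableEq C]
    (A : NonlocalAdversary B C ι ι), IndistinguishableAgainst ε (identical D) (independent D) A

end Distributions

/-- The Haar (uniform) probability distribution over `d`-dimensional pure states: the surface
measure of the unit sphere of `ℂ^d`, normalised to total mass one. -/
noncomputable def haarState (d : ℕ) : Measure (PureState (Fin d)) :=
  ((volume : Measure (EuclideanSpace ℂ (Fin d))).toSphere Set.univ)⁻¹ •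
    (volume : Measure (EuclideanSpace ℂ (Fin d))).toSphere

theorem isProbabilityMeasure_haarState (d : ℕ) [NeZero d] :
    IsProbabilityMeasure (haarState d) := by
  refine ⟨?_⟩
  rw [haarState, Measure.smul_apply, smul_eq_mul]
  refine ENNReal.inv_mul_cancel ?_ (measure_ne_top _ _)
  rw [Ne, Measure.measure_univ_eq_zero]
  exact Measure.toSphere_ne_zero _

end SSI

/-! The error is in fact at most `4 * t / d`, which is stronger than the claim since `t ≤ t ^ 2` and
`√d ≤ d`.

Factor the shared state as `Dᴴ * D`. The probability of a pair of outputs on `u ⊗ v` is then the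
real part of a Hilbert–Schmidt product `∑ j, conj (F j) * G j`, where `F j` depends only on Bob's
state and `G j` only on Charlie's. For `u = ψ^{⊗t}`, each is a polynomial of bidegree `(t, t)` in
`(conj ψ, ψ)`. If both families are close to constants in mean square, then drawing the two states
equal or independent makes little difference: after centring, the terms linear in one family have
the same integral under both laws, and AM-GM bounds the rest
(`abs_integral_diag_sub_integral_prod_le`).

It remains to show that the total mean square deviation is at most `2 * t / d`
(`exists_integral_sq_sandwich_sub_le`). Polynomials in `z = conj ψ`, `w = ψ` carry the Fischer form,
for which multiplication by a variable is adjoint to differentiation. A polynomial `p` of bidegree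
`(r, r)` has mean square on the sphere at most `normSq p / (r! * d.ascFactorial r)`, and the
measurement kernels have total `normSq` at most `t! * d.ascFactorial t`; alone this gives only the
bound 1. The gain comes from `Q = ∑ z i * w i`, which equals 1 on the sphere. Subtracting the
Fischer projection onto `Q ^ t` therefore subtracts a constant, and multiplying the remainder by `Q`
keeps its values on the sphere. On the complement of `Q ^ r`, multiplication by `Q` increases
`normSq` by less than it increases the denominator above, so repeating it improves the bound to
order `r / d`. -/

namespace Fischer

open MvPolynomial Finset
open scoped Nat

/-! ### The Fischer form. -/

section Form

variable {σ : Type*}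

/-- The weight `m!` of a monomial. -/
def weight (m : σ →₀ ℕ) : ℝ := m.prod fun _ k => (k ! : ℝ)

theorem weight_pos (m : σ →₀ ℕ) : 0 < weight m :=
  Finset.prod_pos fun _ _ => by positivity

theorem weight_add_single (m : σ →₀ ℕ) (i : σ) :
    weight (m + Finsupp.single i 1) = (m i + 1) * weight m := by
  classical
  have key (n : σ →₀ ℕ) : weight n = (n i)! * weight (n.erase i) := by
    rw [weight, weight, ← Finsupp.mul_prod_erase' n i _ (by simp)]
  have he : (m + Finsupp.single i 1).erase i = m.erase i := by
    rw [Finsupp.erase_add, Finsupp.erase_single, add_zero]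
  rw [key m, key (m + Finsupp.single i 1), he]
  simp [Nat.factorial_succ, mul_assoc]

/-- The Fischer (Bombieri) sesquilinear form: monomials are orthogonal, and `⟨X^m, X^m⟩ = m!`. -/
noncomputable def form (p q : MvPolynomial σ ℂ) : ℂ :=
  ∑ m ∈ p.support, weight m * (star (coeff m p) * coeff m q)

/-- The square of the norm associated with the Fischer form. -/
noncomputable def normSq (p : MvPolynomial σ ℂ) : ℝ :=
  ∑ m ∈ p.support, weight m * ‖coeff m p‖ ^ 2

theorem form_eq_sum {p : MvPolynomial σ ℂ} {s : Finset (σ →₀ ℕ)} (h : p.support ⊆ s)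
    (q : MvPolynomial σ ℂ) : form p q = ∑ m ∈ s, weight m * (star (coeff m p) * coeff m q) :=
  sum_subset h fun m _ hm => by rw [notMem_support_iff.mp hm]; simp

theorem normSq_eq_sum {p : MvPolynomial σ ℂ} {s : Finset (σ →₀ ℕ)} (h : p.support ⊆ s) :
    normSq p = ∑ m ∈ s, weight m * ‖coeff m p‖ ^ 2 :=
  sum_subset h fun m _ hm => by rw [notMem_support_iff.mp hm]; simp

theorem star_form (p q : MvPolynomial σ ℂ) : star (form p q) = form q p := by
  classical
  rw [form_eq_sum (subset_union_left (s₂ := q.support)),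
    form_eq_sum (subset_union_right (s₁ := p.support)), star_sum]
  refine sum_congr rfl fun m _ => ?_
  simp only [star_mul', RCLike.star_def, Complex.conj_ofReal, Complex.conj_conj]
  ring

theorem form_self (p : MvPolynomial σ ℂ) : form p p = normSq p := by
  rw [form, normSq, Complex.ofReal_sum]
  refine sum_congr rfl fun m _ => ?_
  rw [RCLike.star_def, Complex.conj_mul']
  push_cast
  rfl

theorem normSq_nonneg (p : MvPolynomial σ ℂ) : 0 ≤ normSq p :=
  sum_nonneg fun m _ => mul_nonneg (weight_pos m).le (sq_nonneg _)

@[simp] theorem normSq_zero : normSq (0 : MvPolynomial σ ℂ) = 0 := by simp [normSq]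

theorem form_add_right (p q r : MvPolynomial σ ℂ) : form p (q + r) = form p q + form p r := by
  simp only [form, ← sum_add_distrib, coeff_add]
  exact sum_congr rfl fun _ _ => by ring

theorem form_smul_right (p q : MvPolynomial σ ℂ) (c : ℂ) : form p (c • q) = c * form p q := by
  simp only [form, mul_sum, coeff_smul, smul_eq_mul]
  exact sum_congr rfl fun _ _ => by ring

theorem form_add_left (p q r : MvPolynomial σ ℂ) : form (p + q) r = form p r + form q r := by
  rw [← star_form, form_add_right, star_add, star_form, star_form]

theorem form_smul_left (p q : MvPolynomial σ ℂ) (c : ℂ) :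
    form (c • p) q = star c * form p q := by
  rw [← star_form, form_smul_right, star_mul', star_form]

theorem form_zero_right (p : MvPolynomial σ ℂ) : form p 0 = 0 := by simp [form]

theorem form_sum_right {κ : Type*} (s : Finset κ) (p : MvPolynomial σ ℂ)
    (q : κ → MvPolynomial σ ℂ) : form p (∑ k ∈ s, q k) = ∑ k ∈ s, form p (q k) := by
  classical
  induction s using Finset.induction_on with
  | empty => simp [form_zero_right]
  | insert a s ha ih => rw [sum_insert ha, sum_insert ha, form_add_right, ih]

theorem form_sum_left {κ : Type*} (s : Finset κ) (p : κ → MvPolynomial σ ℂ)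
    (q : MvPolynomial σ ℂ) : form (∑ k ∈ s, p k) q = ∑ k ∈ s, form (p k) q := by
  rw [← star_form, form_sum_right, star_sum]
  simp only [star_form]

/-- Cauchy–Schwarz in weighted AM-GM form, which avoids square roots; in applications `c` is the
operator bound being proved. -/
theorem two_mul_re_form_le (p q : MvPolynomial σ ℂ) {c : ℝ} (hc : 0 < c) :
    2 * (form p q).re ≤ c * normSq p + c⁻¹ * normSq q := by
  classical
  rw [form_eq_sum (subset_union_left (s₂ := q.support)),
    normSq_eq_sum (subset_union_left (s₂ := q.support)),
    normSq_eq_sum (subset_union_right (s₁ := p.support)), Complex.re_sum, mul_sum, mul_sum,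
    mul_sum, ← sum_add_distrib]
  refine sum_le_sum fun m _ => ?_
  rw [Complex.re_ofReal_mul]
  have h1 : (star (coeff m p) * coeff m q).re ≤ ‖coeff m p‖ * ‖coeff m q‖ := by
    refine (Complex.re_le_norm _).trans ?_
    rw [norm_mul, norm_star]
  have h2 : 2 * (‖coeff m p‖ * ‖coeff m q‖) ≤ c * ‖coeff m p‖ ^ 2 + c⁻¹ * ‖coeff m q‖ ^ 2 := by
    have := mul_nonneg (inv_pos.mpr hc).le (sq_nonneg (c * ‖coeff m p‖ - ‖coeff m q‖))
    have hcc : c⁻¹ * c = 1 := inv_mul_cancel₀ hc.ne'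
    linear_combination this + (c * ‖coeff m p‖ ^ 2 - 2 * ‖coeff m p‖ * ‖coeff m q‖) * hcc
  have h3 := mul_le_mul_of_nonneg_left (h2.trans' (mul_le_mul_of_nonneg_left h1 zero_le_two))
    (weight_pos m).le
  linarith

theorem normSq_smul (p : MvPolynomial σ ℂ) (c : ℂ) : normSq (c • p) = ‖c‖ ^ 2 * normSq p := by
  have h : ((normSq (c • p) : ℝ) : ℂ) = ((‖c‖ ^ 2 * normSq p : ℝ) : ℂ) := by
    rw [← form_self, form_smul_left, form_smul_right, form_self, ← mul_assoc, RCLike.star_def,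
      Complex.conj_mul']
    push_cast
    rfl
  exact_mod_cast h

/-- The weights `m!` are chosen for this adjointness: raising an exponent multiplies the weight by
the factor that differentiation produces. -/
theorem form_X_mul (i : σ) (p q : MvPolynomial σ ℂ) :
    form (X i * p) q = form p (pderiv i q) := by
  classical
  induction p using MvPolynomial.induction_on' with
  | add p₁ p₂ h₁ h₂ => rw [mul_add, form_add_left, form_add_left, h₁, h₂]
  | monomial m a =>
    have hm (n : σ →₀ ℕ) (r : MvPolynomial σ ℂ) :
        form (monomial n a) r = weight n * (star a * coeff n r) := by
      rw [form_eq_sum (s := {n}) support_monomial_subset, sum_singleton, coeff_monomial,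
        if_pos rfl]
    rw [mul_comm, ← pow_one (X i), ← monomial_add_single, hm, hm, weight_add_single, coeff_pderiv]
    push_cast
    ring

theorem form_pderiv (i : σ) (p q : MvPolynomial σ ℂ) :
    form (pderiv i p) q = form p (X i * q) := by
  rw [← star_form, ← form_X_mul, star_form]

/-- `normSq` is a weighted sum over coefficients, so the scalar contraction applies to each
coefficient separately. -/
theorem normSq_sum_contraction {Y κ : Type*} [Fintype Y] [Fintype κ] (a : κ → Y → ℂ)
    (ha : ∀ e : Y → ℂ, ∑ k, ‖∑ y, a k y * e y‖ ^ 2 ≤ ∑ y, ‖e y‖ ^ 2)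
    (P : Y → MvPolynomial σ ℂ) :
    ∑ k, normSq (∑ y, a k y • P y) ≤ ∑ y, normSq (P y) := by
  classical
  let s : Finset (σ →₀ ℕ) := univ.biUnion fun y => (P y).support
  have hP (y : Y) : (P y).support ⊆ s := subset_biUnion_of_mem (fun y => (P y).support) (mem_univ y)
  have hk (k : κ) : (∑ y, a k y • P y).support ⊆ s := fun m hm => by
    by_contra hms
    refine (mem_support_iff.mp hm) ?_
    rw [coeff_sum]
    refine sum_eq_zero fun y _ => ?_
    rw [coeff_smul, notMem_support_iff.mp fun h => hms (hP y h), smul_zero]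
  rw [sum_congr rfl fun k _ => normSq_eq_sum (hk k), sum_congr rfl fun y _ => normSq_eq_sum (hP y),
    sum_comm, sum_comm (s := univ)]
  refine sum_le_sum fun m _ => ?_
  rw [← mul_sum, ← mul_sum]
  refine mul_le_mul_of_nonneg_left ?_ (weight_pos m).le
  simpa only [coeff_sum, coeff_smul, smul_eq_mul] using ha fun y => coeff m (P y)

end Form

/-! ### Bihomogeneous polynomials, multiplication by `Q` and its adjoint Laplacian. -/

section Bidegree

variable {ι : Type*}

/-- Polynomials in the variables `z = X (inl ·)` and `w = X (inr ·)` that are homogeneous of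
degree `r` in `z` and of degree `s` in `w`. -/
structure Bihomogeneous (p : MvPolynomial (ι ⊕ ι) ℂ) (r s : ℕ) : Prop where
  left : IsWeightedHomogeneous (Sum.elim 1 0 : ι ⊕ ι → ℕ) p r
  right : IsWeightedHomogeneous (Sum.elim 0 1 : ι ⊕ ι → ℕ) p s

variable {p q : MvPolynomial (ι ⊕ ι) ℂ} {r s : ℕ}

namespace Bihomogeneous

theorem add (hp : Bihomogeneous p r s) (hq : Bihomogeneous q r s) : Bihomogeneous (p + q) r s :=
  ⟨hp.left.add hq.left, hp.right.add hq.right⟩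

theorem smul (hp : Bihomogeneous p r s) (c : ℂ) : Bihomogeneous (c • p) r s := by
  rw [smul_eq_C_mul]
  exact ⟨hp.left.C_mul c, hp.right.C_mul c⟩

theorem sum {κ : Type*} (t : Finset κ) {P : κ → MvPolynomial (ι ⊕ ι) ℂ}
    (hP : ∀ k, Bihomogeneous (P k) r s) : Bihomogeneous (∑ k ∈ t, P k) r s :=
  ⟨IsWeightedHomogeneous.sum t P r fun k _ => (hP k).left,
    IsWeightedHomogeneous.sum t P s fun k _ => (hP k).right⟩

theorem one : Bihomogeneous (1 : MvPolynomial (ι ⊕ ι) ℂ) 0 0 :=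
  ⟨isWeightedHomogeneous_one _ _, isWeightedHomogeneous_one _ _⟩

theorem X_inl_mul (hp : Bihomogeneous p r s) (i : ι) :
    Bihomogeneous (X (Sum.inl i) * p) (r + 1) s := by
  constructor
  · simpa [add_comm] using (isWeightedHomogeneous_X ℂ (Sum.elim 1 0) (Sum.inl i)).mul hp.left
  · simpa using (isWeightedHomogeneous_X ℂ (Sum.elim 0 1) (Sum.inl i)).mul hp.right

theorem X_inr_mul (hp : Bihomogeneous p r s) (i : ι) :
    Bihomogeneous (X (Sum.inr i) * p) r (s + 1) := by
  constructor
  · simpa using (isWeightedHomogeneous_X ℂ (Sum.elim 1 0) (Sum.inr i)).mul hp.left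
  · simpa [add_comm] using (isWeightedHomogeneous_X ℂ (Sum.elim 0 1) (Sum.inr i)).mul hp.right

theorem pderiv_inl (hp : Bihomogeneous p (r + 1) s) (i : ι) :
    Bihomogeneous (pderiv (Sum.inl i) p) r s :=
  ⟨hp.left.pderiv rfl, hp.right.pderiv rfl⟩

theorem pderiv_inr (hp : Bihomogeneous p r (s + 1)) (i : ι) :
    Bihomogeneous (pderiv (Sum.inr i) p) r s :=
  ⟨hp.left.pderiv rfl, hp.right.pderiv rfl⟩

variable [Fintype ι]

theorem euler_inl (hp : Bihomogeneous p r s) :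
    ∑ i, X (Sum.inl i) * pderiv (Sum.inl i) p = (r : ℂ) • p := by
  have h := hp.left.sum_weight_X_mul_pderiv
  simpa [Fintype.sum_sum_type, ← Nat.cast_smul_eq_nsmul ℂ] using h

theorem euler_inr (hp : Bihomogeneous p r s) :
    ∑ i, X (Sum.inr i) * pderiv (Sum.inr i) p = (s : ℂ) • p := by
  have h := hp.right.sum_weight_X_mul_pderiv
  simpa [Fintype.sum_sum_type, ← Nat.cast_smul_eq_nsmul ℂ] using h

theorem sum_normSq_pderiv_inl (hp : Bihomogeneous p r s) :
    ∑ i, normSq (pderiv (Sum.inl i) p) = r * normSq p := by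
  have h : ((∑ i, normSq (pderiv (Sum.inl i) p) : ℝ) : ℂ) = ((r * normSq p : ℝ) : ℂ) := by
    push_cast
    simp only [← form_self]
    simp only [form_pderiv, ← form_sum_right, hp.euler_inl, form_smul_right]
  exact_mod_cast h

theorem sum_normSq_X_inr_mul (hp : Bihomogeneous p r s) :
    ∑ i, normSq (X (Sum.inr i) * p) = (Fintype.card ι + s) * normSq p := by
  have h : ((∑ i, normSq (X (Sum.inr i) * p) : ℝ) : ℂ) =
      (((Fintype.card ι + s) * normSq p : ℝ) : ℂ) := by
    push_cast
    simp only [← form_self]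
    simp only [form_X_mul, pderiv_mul, pderiv_X_self, one_mul, ← form_sum_right,
      sum_add_distrib, hp.euler_inr, form_smul_right, form_add_right, sum_const, card_univ]
    rw [nsmul_eq_mul]
    ring
  exact_mod_cast h

/-- The adjoint of `P ↦ ∑ z i * P i` is the gradient in `z`, whose squared norm on `z`-degree `r +
1` is `r + 1` by Euler's identity. -/
theorem normSq_sum_X_inl_mul_le {P : ι → MvPolynomial (ι ⊕ ι) ℂ}
    (hP : ∀ i, Bihomogeneous (P i) r s) :
    normSq (∑ i, X (Sum.inl i) * P i) ≤ (r + 1) * ∑ i, normSq (P i) := by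
  set q := ∑ i, X (Sum.inl i) * P i with hq
  have hqb : Bihomogeneous q (r + 1) s := sum _ fun i => (hP i).X_inl_mul i
  have hc : (0 : ℝ) < r + 1 := by positivity
  have h1 : normSq q = ∑ i, (form (P i) (pderiv (Sum.inl i) q)).re := by
    have h : form q q = ∑ i, form (P i) (pderiv (Sum.inl i) q) := by
      conv_lhs => rw [hq, form_sum_left, ← hq]
      simp only [form_X_mul]
    rw [form_self] at h
    rw [← Complex.re_sum, ← h, Complex.ofReal_re]
  have h2 := sum_le_sum fun i (_ : i ∈ univ) =>
    two_mul_re_form_le (P i) (pderiv (Sum.inl i) q) hc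
  rw [← mul_sum, ← h1, sum_add_distrib, ← mul_sum, ← mul_sum, hqb.sum_normSq_pderiv_inl] at h2
  have h3 : ((r : ℝ) + 1)⁻¹ * (((r + 1 : ℕ) : ℝ) * normSq q) = normSq q := by
    push_cast
    field_simp
  linarith

end Bihomogeneous

variable [Fintype ι]

/-- Multiplication by the quadratic form `∑ i, z i * w i`. -/
noncomputable def raise (p : MvPolynomial (ι ⊕ ι) ℂ) : MvPolynomial (ι ⊕ ι) ℂ :=
  ∑ i, X (Sum.inl i) * (X (Sum.inr i) * p)

/-- The Laplacian `∑ i, ∂/∂(z i) ∂/∂(w i)`. -/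
noncomputable def lower (p : MvPolynomial (ι ⊕ ι) ℂ) : MvPolynomial (ι ⊕ ι) ℂ :=
  ∑ i, pderiv (Sum.inr i) (pderiv (Sum.inl i) p)

theorem form_raise (p q : MvPolynomial (ι ⊕ ι) ℂ) : form (raise p) q = form p (lower q) := by
  simp only [raise, lower, form_sum_left, form_sum_right, form_X_mul]

theorem form_lower (p q : MvPolynomial (ι ⊕ ι) ℂ) : form (lower p) q = form p (raise q) := by
  rw [← star_form, ← form_raise, star_form]

theorem raise_smul (c : ℂ) (p : MvPolynomial (ι ⊕ ι) ℂ) : raise (c • p) = c • raise p := by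
  simp only [raise, smul_sum, mul_smul_comm]

theorem Bihomogeneous.raise (hp : Bihomogeneous p r s) :
    Bihomogeneous (raise p) (r + 1) (s + 1) :=
  Bihomogeneous.sum _ fun i => (hp.X_inr_mul i).X_inl_mul i

theorem Bihomogeneous.lower (hp : Bihomogeneous p (r + 1) (s + 1)) :
    Bihomogeneous (lower p) r s :=
  Bihomogeneous.sum _ fun i => (hp.pderiv_inl i).pderiv_inr i

/-- The `sl₂` commutation relation: the diagonal terms of the product rule give the dimension and
two Euler operators. -/
theorem Bihomogeneous.lower_raise (hp : Bihomogeneous p r s) :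
    Fischer.lower (Fischer.raise p) =
      Fischer.raise (Fischer.lower p) + (Fintype.card ι + r + s : ℂ) • p := by
  classical
  have h (i j : ι) : pderiv (Sum.inr j) (pderiv (Sum.inl j)
      (X (Sum.inl i) * (X (Sum.inr i) * p) : MvPolynomial (ι ⊕ ι) ℂ)) =
      X (Sum.inl i) * (X (Sum.inr i) * pderiv (Sum.inr j) (pderiv (Sum.inl j) p)) +
      (if i = j then p else 0) + (if i = j then X (Sum.inl j) * pderiv (Sum.inl j) p else 0) +
      (if i = j then X (Sum.inr j) * pderiv (Sum.inr j) p else 0) := by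
    by_cases hij : i = j
    · subst hij
      simp
      ring
    · simp [hij]
  simp only [Fischer.lower, Fischer.raise, map_sum, h, mul_sum]
  rw [sum_comm]
  simp only [sum_add_distrib, sum_ite_eq, mem_univ, if_true, hp.euler_inl,
    hp.euler_inr, sum_const, card_univ]
  rw [← Nat.cast_smul_eq_nsmul ℂ, add_smul, add_smul]
  abel

theorem Bihomogeneous.normSq_raise (hp : Bihomogeneous p r s) :
    normSq (Fischer.raise p) =
      normSq (Fischer.lower p) + (Fintype.card ι + r + s) * normSq p := by
  have h := form_raise p (Fischer.raise p)
  rw [form_self, hp.lower_raise, form_add_right, ← form_lower, form_smul_right, form_self, form_self]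
    at h
  exact_mod_cast h

/-- The power `(∑ i, z i * w i) ^ k`. -/
noncomputable def quadPow (ι : Type*) [Fintype ι] (k : ℕ) : MvPolynomial (ι ⊕ ι) ℂ :=
  raise^[k] 1

theorem quadPow_succ (k : ℕ) : quadPow ι (k + 1) = raise (quadPow ι k) :=
  Function.iterate_succ_apply' _ _ _

theorem bihomogeneous_quadPow (k : ℕ) : Bihomogeneous (quadPow ι k) k k := by
  induction k with
  | zero => exact Bihomogeneous.one
  | succ k ih => rw [quadPow_succ]; exact ih.raise

theorem exists_lower_quadPow (k : ℕ) : ∃ c : ℂ, lower (quadPow ι (k + 1)) = c • quadPow ι k := by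
  induction k with
  | zero =>
    refine ⟨(Fintype.card ι + (0 : ℕ) + (0 : ℕ) : ℂ), ?_⟩
    rw [quadPow_succ, (bihomogeneous_quadPow 0).lower_raise]
    simp [quadPow, lower, raise]
  | succ k ih =>
    obtain ⟨c, hc⟩ := ih
    refine ⟨c + (Fintype.card ι + (k + 1 : ℕ) + (k + 1 : ℕ)), ?_⟩
    rw [quadPow_succ, (bihomogeneous_quadPow _).lower_raise, hc, raise_smul, ← quadPow_succ]
    module

/-- Lowering a power of `Q` gives a multiple of the previous power, so orthogonality survives
raising. -/
theorem form_quadPow_raise (h : form (quadPow ι r) p = 0) :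
    form (quadPow ι (r + 1)) (raise p) = 0 := by
  obtain ⟨c, hc⟩ := exists_lower_quadPow (ι := ι) r
  rw [← form_lower, hc, form_smul_left, h, mul_zero]

/-- Induction on the degree: a bound for `lower` on bidegree `r + 1` bounds `raise` there through
the commutation relation, and hence bounds its adjoint, `lower` on bidegree `r + 2`. Orthogonality
to powers of `Q` enters at the base, where `lower p` is a constant orthogonal to 1 and so vanishes.
-/
theorem Bihomogeneous.normSq_lower_le (hp : Bihomogeneous p (r + 1) (r + 1))
    (h : form (quadPow ι (r + 1)) p = 0) :
    normSq (Fischer.lower p) ≤ r * (Fintype.card ι + r + 1) * normSq p := by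
  classical
  induction r generalizing p with
  | zero =>
    have h0 : form 1 (Fischer.lower p) = 0 := by
      rw [← form_raise]; simpa [quadPow] using h
    obtain ⟨c, hc⟩ : ∃ c, Fischer.lower p = C c := by
      refine ⟨coeff 0 (Fischer.lower p), ?_⟩
      ext m
      rw [coeff_C]
      split_ifs with hm
      · rw [hm]
      · by_contra hne
        refine hm (Finsupp.ext fun x => ?_)
        have h1 := hp.lower.left hne
        have h2 := hp.lower.right hne
        rw [Finsupp.weight_apply, Finsupp.sum_fintype _ _ (by simp)] at h1 h2
        simp only [Fintype.sum_sum_type, smul_eq_mul, Sum.elim_inl, Sum.elim_inr, Pi.one_apply,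
          Pi.zero_apply, mul_one, mul_zero, sum_const_zero, add_zero, zero_add,
          sum_eq_zero_iff, mem_univ, true_imp_iff] at h1 h2
        cases x with
        | inl i => exact (h1 i).symm
        | inr i => exact (h2 i).symm
    have hc0 : c = 0 := by
      have h1 : form (1 : MvPolynomial (ι ⊕ ι) ℂ) (C c) = c := by
        rw [form_eq_sum (s := {0}) (by rw [← C_1]; exact support_monomial_subset)]
        simp [weight]
      rw [← h1, ← hc, h0]
    simp [hc, hc0]
  | succ r ih =>
    set q := Fischer.lower p with hq
    have hqb : Bihomogeneous q (r + 1) (r + 1) := hp.lower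
    have hq0 : form (quadPow ι (r + 1)) q = 0 := by rw [← form_raise, ← quadPow_succ, h]
    -- This is `r * (d + r + 1)`, from the induction hypothesis, plus the commutator `d + 2 * (r +
    -- 1)`.
    set c : ℝ := (r + 1) * (Fintype.card ι + r + 2) with hc
    have hcpos : 0 < c := by positivity
    have h1 : normSq (Fischer.raise q) ≤ c * normSq q := by
      rw [hqb.normSq_raise]
      have := ih hqb hq0
      push_cast
      rw [hc]
      linarith
    have h2 : normSq q = (form p (Fischer.raise q)).re := by
      rw [← form_lower, ← hq, form_self, Complex.ofReal_re]
    have h3 := two_mul_re_form_le p (Fischer.raise q) hcpos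
    have h4 : c⁻¹ * normSq (Fischer.raise q) ≤ normSq q := by
      rw [inv_mul_le_iff₀ hcpos]; exact h1
    have h5 : normSq q ≤ c * normSq p := by linarith
    refine h5.trans_eq ?_
    rw [hc]
    push_cast
    ring

theorem Bihomogeneous.normSq_raise_le (hr : 0 < r) (hp : Bihomogeneous p r r)
    (h : form (quadPow ι r) p = 0) :
    normSq (Fischer.raise p) ≤ r * (Fintype.card ι + r + 1) * normSq p := by
  obtain ⟨k, rfl⟩ : ∃ k, r = k + 1 := ⟨r - 1, by omega⟩
  rw [hp.normSq_raise]
  have := hp.normSq_lower_le h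
  push_cast
  linarith

end Bidegree

end Fischer

namespace Fischer

open Finset
open scoped Nat

/-! ### Gaussian integrals and Haar moments. -/

section Polar

variable {E : Type*} [NormedAddCommGroup E] [NormedSpace ℝ E] [MeasurableSpace E] [BorelSpace E]
  [FiniteDimensional ℝ E] [Nontrivial E]

/-- In polar coordinates the integrand separates, and the radial factor is a Gamma integral. -/
theorem integral_homogeneous_mul_gaussian (μ : Measure E) [μ.IsAddHaarMeasure] (F : E → ℂ) (n : ℕ)
    (hF : ∀ (r : ℝ) (x : E), 0 < r → F (r • x) = (r : ℂ) ^ n * F x) :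
    ∫ x, F x * (Real.exp (-‖x‖ ^ 2) : ℂ) ∂μ =
      (∫ ψ, F (ψ : Metric.sphere (0 : E) 1) ∂μ.toSphere) *
        (Real.Gamma ((Module.finrank ℝ E + n) / 2) / 2 : ℝ) := by
  have hdim : 0 < Module.finrank ℝ E := Module.finrank_pos
  calc
    _ = ∫ x : ({(0)}ᶜ : Set E), F x.1 * (Real.exp (-‖x.1‖ ^ 2) : ℂ) ∂(μ.comap (↑)) := by
      rw [integral_subtype_comap (measurableSet_singleton _).compl
        fun x ↦ F x * (Real.exp (-‖x‖ ^ 2) : ℂ), restrict_compl_singleton]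
    _ = ∫ x, F x.1 * ((x.2.1 ^ n * Real.exp (-x.2.1 ^ 2) : ℝ) : ℂ)
          ∂μ.toSphere.prod (.volumeIoiPow (Module.finrank ℝ E - 1)) := by
      rw [← μ.measurePreserving_homeomorphUnitSphereProd.integral_comp
        (Homeomorph.measurableEmbedding _)]
      refine integral_congr_ae (.of_forall fun x => ?_)
      have hx : 0 < ‖x.1‖ := norm_pos_iff.mpr x.2
      have h := hF ‖x.1‖ (‖x.1‖⁻¹ • x.1) hx
      rw [smul_inv_smul₀ hx.ne'] at h
      simp only [homeomorphUnitSphereProd_apply_snd_coe, homeomorphUnitSphereProd_apply_fst_coe]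
      conv_lhs => rw [h]
      push_cast
      ring
    _ = (∫ ψ, F (ψ : Metric.sphere (0 : E) 1) ∂μ.toSphere) *
        ∫ y : Set.Ioi (0 : ℝ), ((y.1 ^ n * Real.exp (-y.1 ^ 2) : ℝ) : ℂ)
          ∂.volumeIoiPow (Module.finrank ℝ E - 1) :=
      integral_prod_mul (fun ψ : Metric.sphere (0 : E) 1 => F ψ)
        (fun y : Set.Ioi (0 : ℝ) => ((y.1 ^ n * Real.exp (-y.1 ^ 2) : ℝ) : ℂ))
    _ = _ := by
      congr 1
      rw [integral_complex_ofReal]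
      congr 1
      simp only [Measure.volumeIoiPow, ENNReal.ofReal]
      rw [integral_withDensity_eq_integral_smul
          ((measurable_subtype_coe.pow_const _).real_toNNReal),
        integral_subtype_comap measurableSet_Ioi fun a : ℝ ↦
          Real.toNNReal (a ^ (Module.finrank ℝ E - 1)) • (a ^ n * Real.exp (-a ^ 2))]
      have h := integral_rpow_mul_exp_neg_rpow (p := 2)
        (q := ((Module.finrank ℝ E - 1 + n : ℕ) : ℝ)) two_pos
        (lt_of_lt_of_le (by norm_num) (Nat.cast_nonneg _))
      have h2 : (((Module.finrank ℝ E - 1 + n : ℕ) : ℝ) + 1) / 2 =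
          (Module.finrank ℝ E + n) / 2 := by
        congr 1
        rw [← Nat.cast_add_one, ← Nat.cast_add]
        congr 1
        omega
      rw [h2, one_div, inv_mul_eq_div] at h
      rw [← h]
      refine setIntegral_congr_fun measurableSet_Ioi fun x (hx : 0 < x) ↦ ?_
      rw [NNReal.smul_def, Real.coe_toNNReal _ (pow_nonneg hx.le _), Real.rpow_natCast, pow_add,
        smul_eq_mul, mul_assoc, Real.rpow_two]

end Polar

theorem integral_complex_monomial_gaussian (a b : ℕ) :
    ∫ z : ℂ, z ^ a * star z ^ b * (Real.exp (-‖z‖ ^ 2) : ℂ) =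
      if a = b then ((Real.pi * a ! : ℝ) : ℂ) else 0 := by
  split_ifs with hab
  · subst hab
    have h := Complex.integral_rpow_mul_exp_neg_rpow (p := 2) (q := ((2 * a : ℕ) : ℝ)) one_le_two
      (lt_of_lt_of_le (by norm_num) (Nat.cast_nonneg _))
    have h2 : 2 * Real.pi / 2 * Real.Gamma ((((2 * a : ℕ) : ℝ) + 2) / 2) = Real.pi * a ! := by
      rw [show (((2 * a : ℕ) : ℝ) + 2) / 2 = a + 1 by push_cast; ring, Real.Gamma_nat_eq_factorial]
      ring
    rw [h2] at h
    rw [← h, ← integral_complex_ofReal]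
    refine integral_congr_ae (.of_forall fun z => ?_)
    simp only [Real.rpow_natCast, Real.rpow_two]
    rw [← mul_pow, RCLike.star_def, Complex.mul_conj', pow_mul]
    push_cast
    rfl
  · wlog hlt : a < b generalizing a b with H
    · have h := H b a (Ne.symm hab) (by omega)
      have h2 := congrArg star h
      rw [star_zero, RCLike.star_def, ← integral_conj] at h2
      rw [← h2]
      refine integral_congr_ae (.of_forall fun z => ?_)
      simp only [map_mul, map_pow, RCLike.star_def, Complex.conj_conj, Complex.conj_ofReal]
      ring
    obtain ⟨k, hk, rfl⟩ : ∃ k : ℕ, 0 < k ∧ b = a + k := ⟨b - a, by omega, by omega⟩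
    -- Since `ζ ^ k = -1`, rotation by `ζ` negates the integrand, so the integral equals its own
    -- negative.
    set ζ : Circle := Circle.exp (Real.pi / k) with hζ
    have hζk : ((ζ : ℂ)) ^ k = -1 := by
      rw [hζ, Circle.coe_exp, ← Complex.exp_nat_mul, ← Complex.exp_pi_mul_I]
      congr 1
      have : (k : ℂ) ≠ 0 := Nat.cast_ne_zero.mpr hk.ne'
      push_cast
      field_simp
    have hζn : (ζ : ℂ) * star (ζ : ℂ) = 1 := by
      rw [RCLike.star_def, Complex.mul_conj', Circle.norm_coe]
      simp
    have h1 := (rotation ζ).measurePreserving.integral_comp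
      (rotation ζ).toHomeomorph.measurableEmbedding
      (fun z : ℂ => z ^ a * star z ^ (a + k) * (Real.exp (-‖z‖ ^ 2) : ℂ))
    have h2 (z : ℂ) : (rotation ζ z) ^ a * star (rotation ζ z) ^ (a + k) *
        (Real.exp (-‖rotation ζ z‖ ^ 2) : ℂ) =
        -(z ^ a * star z ^ (a + k) * (Real.exp (-‖z‖ ^ 2) : ℂ)) := by
      rw [LinearIsometryEquiv.norm_map, rotation_apply, star_mul', mul_pow, mul_pow]
      have h3 : (ζ : ℂ) ^ a * star (ζ : ℂ) ^ (a + k) = -1 := by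
        rw [pow_add, ← mul_assoc, ← mul_pow, hζn, one_pow, one_mul, ← star_pow, hζk]
        simp
      linear_combination (z ^ a * star z ^ (a + k) * (Real.exp (-‖z‖ ^ 2) : ℂ)) * h3
    simp only [h2, integral_neg] at h1
    linear_combination (-1 / 2 : ℂ) * h1

section Moments

variable {d : ℕ}

theorem exists_volume_eq_smul_map (d : ℕ) : ∃ c : NNReal, 0 < c ∧
    (volume : Measure (EuclideanSpace ℂ (Fin d))) =
      c • (volume : Measure (Fin d → ℂ)).map (WithLp.toLp 2) := by
  let e : (Fin d → ℂ) ≃L[ℝ] EuclideanSpace ℂ (Fin d) :=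
    (PiLp.continuousLinearEquiv 2 ℝ fun _ : Fin d => ℂ).symm
  have h : ((volume : Measure (Fin d → ℂ)).map e).IsAddHaarMeasure := inferInstance
  exact ⟨_, Measure.addHaarScalarFactor_pos_of_isAddHaarMeasure _ _,
    Measure.isAddLeftInvariant_eq_smul (volume : Measure (EuclideanSpace ℂ (Fin d)))
      ((volume : Measure (Fin d → ℂ)).map e)⟩

theorem integral_monomial_gaussian (d : ℕ) : ∃ c : ℂ, c ≠ 0 ∧ ∀ α β : Fin d → ℕ,
    ∫ x : EuclideanSpace ℂ (Fin d), (∏ i, x i ^ α i * star (x i) ^ β i) *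
      (Real.exp (-‖x‖ ^ 2) : ℂ) = if α = β then c * ∏ i, ((α i)! : ℂ) else 0 := by
  obtain ⟨c, hc0, hc⟩ := exists_volume_eq_smul_map d
  refine ⟨c * (Real.pi : ℂ) ^ d, ?_, fun α β => ?_⟩
  · refine mul_ne_zero ?_ (pow_ne_zero _ (by exact_mod_cast Real.pi_ne_zero))
    exact_mod_cast hc0.ne'
  · have hemb : MeasurableEmbedding (WithLp.toLp 2 : (Fin d → ℂ) → EuclideanSpace ℂ (Fin d)) :=
      (PiLp.continuousLinearEquiv 2 ℝ fun _ : Fin d => ℂ).symm.toHomeomorph.measurableEmbedding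
    have h (x : Fin d → ℂ) : (∏ i, x i ^ α i * star (x i) ^ β i) *
        (Real.exp (-‖(WithLp.toLp 2 x : EuclideanSpace ℂ (Fin d))‖ ^ 2) : ℂ) =
        ∏ i, x i ^ α i * star (x i) ^ β i * (Real.exp (-‖x i‖ ^ 2) : ℂ) := by
      rw [EuclideanSpace.norm_sq_eq, ← sum_neg_distrib, Real.exp_sum, Complex.ofReal_prod,
        ← prod_mul_distrib]
    rw [hc, integral_smul_nnreal_measure, hemb.integral_map]
    simp only [h]
    rw [volume_pi, integral_fintype_prod_eq_prod (f := fun i (z : ℂ) =>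
      z ^ α i * star z ^ β i * (Real.exp (-‖z‖ ^ 2) : ℂ))]
    simp only [integral_complex_monomial_gaussian]
    split_ifs with hab
    · subst hab
      simp [prod_mul_distrib, NNReal.smul_def, mul_assoc]
    · obtain ⟨i, hi⟩ := Function.ne_iff.mp hab
      rw [prod_eq_zero (mem_univ i) (if_neg hi), smul_zero]

theorem ascFactorial_pos_of_neZero (d s : ℕ) [NeZero d] : 0 < d.ascFactorial s := by
  obtain ⟨k, rfl⟩ := Nat.exists_eq_succ_of_ne_zero (NeZero.ne d)
  exact Nat.ascFactorial_pos k s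

theorem integral_haarState (d : ℕ) [NeZero d] (f : SSI.PureState (Fin d) → ℂ) :
    ∫ ψ, f ψ ∂SSI.haarState d =
      (((volume : Measure (EuclideanSpace ℂ (Fin d))).toSphere.real Set.univ)⁻¹ : ℝ) *
        ∫ ψ, f ψ ∂(volume : Measure (EuclideanSpace ℂ (Fin d))).toSphere := by
  rw [SSI.haarState, integral_smul_measure, ENNReal.toReal_inv, Complex.real_smul]
  rfl

/-- The Gaussian integral factors over coordinates, and polar coordinates transfer it to the sphere.
-/
theorem integral_monomial_haarState (d : ℕ) [NeZero d] (s : ℕ) (α β : Fin d → ℕ)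
    (hα : ∑ i, α i = s) (hβ : ∑ i, β i = s) :
    ∫ ψ, ∏ i, ψ.1 i ^ α i * star (ψ.1 i) ^ β i ∂SSI.haarState d =
      if α = β then (∏ i, ((α i)! : ℂ)) / d.ascFactorial s else 0 := by
  obtain ⟨c, hc, hG⟩ := integral_monomial_gaussian d
  set μ := (volume : Measure (EuclideanSpace ℂ (Fin d)))
  have hfin : Module.finrank ℝ (EuclideanSpace ℂ (Fin d)) = 2 * d := by
    rw [← Module.finrank_mul_finrank ℝ ℂ, Complex.finrank_real_complex, finrank_euclideanSpace_fin]
  have hd : 0 < d := Nat.pos_of_neZero d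
  have hpolar (s : ℕ) (α β : Fin d → ℕ) (hα : ∑ i, α i = s) (hβ : ∑ i, β i = s) :
      (if α = β then c * ∏ i, ((α i)! : ℂ) else 0) =
      (∫ ψ, ∏ i, ψ.1 i ^ α i * star (ψ.1 i) ^ β i ∂μ.toSphere) *
        (((d + s - 1)! : ℝ) / 2 : ℝ) := by
    rw [← hG α β, integral_homogeneous_mul_gaussian μ _ (2 * s) fun r x hr => ?_, hfin]
    · congr 4
      rw [show (((2 * d : ℕ) : ℝ) + (2 * s : ℕ)) / 2 = ((d + s - 1 : ℕ) : ℝ) + 1 by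
        rw [← Nat.cast_add_one, Nat.sub_add_cancel (by omega)]; push_cast; ring,
        Real.Gamma_nat_eq_factorial]
    · have h (i : Fin d) : (r • x) i ^ α i * star ((r • x) i) ^ β i =
          (r : ℂ) ^ α i * (r : ℂ) ^ β i * (x i ^ α i * star (x i) ^ β i) := by
        simp only [PiLp.smul_apply, Complex.real_smul, star_mul', RCLike.star_def,
          Complex.conj_ofReal, mul_pow]
        ring
      simp only [h]
      rw [prod_mul_distrib, prod_mul_distrib, prod_pow_eq_pow_sum, prod_pow_eq_pow_sum, hα, hβ,
        two_mul, pow_add]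
  -- Degree zero expresses the total sphere mass through `c`, so the unknown normalisation cancels.
  have h0 := hpolar 0 0 0 (by simp) (by simp)
  have h1 := hpolar s α β hα hβ
  have hfac : ((d.ascFactorial s : ℕ) : ℂ) * ((d - 1)! : ℂ) = ((d + s - 1)! : ℂ) := by
    obtain ⟨k, rfl⟩ : ∃ k, d = k + 1 := ⟨d - 1, by omega⟩
    rw [mul_comm]
    exact_mod_cast (by
      rw [Nat.add_sub_cancel, Nat.factorial_mul_ascFactorial]
      congr 1
      omega : (k + 1 - 1)! * (k + 1).ascFactorial s = (k + 1 + s - 1)!)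
  have hd1 : ((d - 1)! : ℂ) ≠ 0 := by exact_mod_cast (Nat.factorial_pos _).ne'
  have hds : ((d.ascFactorial s : ℕ) : ℂ) ≠ 0 := by
    exact_mod_cast (ascFactorial_pos_of_neZero d s).ne'
  rw [integral_haarState]
  simp only [Pi.zero_apply, pow_zero, mul_one, prod_const_one, integral_const, if_true,
    Nat.factorial_zero, Nat.cast_one, add_zero, Complex.real_smul] at h0
  push_cast at h0 h1 ⊢
  set V : ℂ := ((μ.toSphere.real Set.univ : ℝ) : ℂ)
  have hV : V ≠ 0 := by
    intro hV
    rw [hV] at h0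
    simp [hc] at h0
  rw [← hfac] at h1
  split_ifs at h1 ⊢ with hab
  · rw [h0] at h1
    field_simp at h1 ⊢
    exact (mul_comm _ _).trans h1.symm
  · have : (∫ ψ, ∏ i, ψ.1 i ^ α i * star (ψ.1 i) ^ β i ∂μ.toSphere) = 0 := by
      by_contra h
      refine mul_ne_zero h ?_ h1.symm
      simp [hds, hd1]
    rw [this, mul_zero]

end Moments

end Fischer

namespace Fischer

open MvPolynomial Finset SSI
open scoped Nat

/-! ### Mean squares of polynomials on the sphere. -/

section Evaluation

variable {ι : Type*} [Fintype ι]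

/-- The value of `p(z, w)` at `z = conj ψ`, `w = ψ`. -/
noncomputable def evalAt (p : MvPolynomial (ι ⊕ ι) ℂ) (ψ : PureState ι) : ℂ :=
  eval (Sum.elim (fun i => star (ψ.1 i)) fun i => ψ.1 i) p

theorem continuous_evalAt (p : MvPolynomial (ι ⊕ ι) ℂ) : Continuous (evalAt p) := by
  refine (MvPolynomial.continuous_eval p).comp (continuous_pi fun x => ?_)
  cases x <;> simp only [Sum.elim_inl, Sum.elim_inr] <;> fun_prop

theorem evalAt_add (p q : MvPolynomial (ι ⊕ ι) ℂ) (ψ : PureState ι) :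
    evalAt (p + q) ψ = evalAt p ψ + evalAt q ψ := map_add _ _ _

theorem evalAt_smul (c : ℂ) (p : MvPolynomial (ι ⊕ ι) ℂ) (ψ : PureState ι) :
    evalAt (c • p) ψ = c * evalAt p ψ := smul_eval _ _ _

theorem evalAt_raise (p : MvPolynomial (ι ⊕ ι) ℂ) (ψ : PureState ι) :
    evalAt (raise p) ψ = evalAt p ψ := by
  have h : ∑ i, star (ψ.1 i) * ψ.1 i = 1 := by
    have := sum_normSq ψ
    simp only [RCLike.star_def, Complex.conj_mul']
    exact_mod_cast this
  simp only [evalAt, raise, map_sum, map_mul, eval_X, Sum.elim_inl, Sum.elim_inr, ← mul_assoc]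
  rw [← sum_mul, h, one_mul]

theorem evalAt_quadPow (k : ℕ) (ψ : PureState ι) : evalAt (quadPow ι k) ψ = 1 := by
  induction k with
  | zero => simp [quadPow, evalAt]
  | succ k ih => rw [quadPow_succ, evalAt_raise, ih]

theorem weight_eq_prod {σ : Type*} [Fintype σ] (m : σ →₀ ℕ) : weight m = ∏ x, ((m x)! : ℝ) :=
  Finsupp.prod_fintype _ _ (by simp)

theorem Bihomogeneous.sum_exponent {p : MvPolynomial (ι ⊕ ι) ℂ} {r s : ℕ}
    (hp : Bihomogeneous p r s) {m : ι ⊕ ι →₀ ℕ} (hm : m ∈ p.support) :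
    ∑ i, m (Sum.inl i) = r ∧ ∑ i, m (Sum.inr i) = s := by
  have h1 := hp.left (mem_support_iff.mp hm)
  have h2 := hp.right (mem_support_iff.mp hm)
  rw [Finsupp.weight_apply, Finsupp.sum_fintype _ _ (by simp)] at h1 h2
  simpa [Fintype.sum_sum_type] using And.intro h1 h2

end Evaluation

section Haar

variable {d : ℕ} [NeZero d]

attribute [local instance] isProbabilityMeasure_haarState

theorem integrable_haarState {F : Type*} [NormedAddCommGroup F] {f : PureState (Fin d) → F}
    (hf : Continuous f) : Integrable f (haarState d) :=
  hf.integrable_of_hasCompactSupport (HasCompactSupport.of_compactSpace f)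

theorem Bihomogeneous.integral_sq_evalAt_zero {p : MvPolynomial (Fin d ⊕ Fin d) ℂ} {s : ℕ}
    (hp : Bihomogeneous p 0 s) :
    ∫ ψ, ‖evalAt p ψ‖ ^ 2 ∂haarState d = normSq p / d.ascFactorial s := by
  have hl (m) (hm : m ∈ p.support) (i : Fin d) : m (Sum.inl i) = 0 :=
    sum_eq_zero_iff.mp (hp.sum_exponent hm).1 i (mem_univ i)
  have he (ψ : PureState (Fin d)) :
      evalAt p ψ = ∑ m ∈ p.support, coeff m p * ∏ i, ψ.1 i ^ m (Sum.inr i) := by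
    rw [evalAt, eval_eq']
    refine sum_congr rfl fun m hm => ?_
    rw [Fintype.prod_sum_type]
    simp [hl m hm]
  have hsq (ψ : PureState (Fin d)) : ((‖evalAt p ψ‖ ^ 2 : ℝ) : ℂ) =
      ∑ m ∈ p.support, ∑ n ∈ p.support, coeff m p * star (coeff n p) *
        ∏ i, ψ.1 i ^ m (Sum.inr i) * star (ψ.1 i) ^ n (Sum.inr i) := by
    push_cast
    rw [← Complex.mul_conj', ← RCLike.star_def, he ψ, star_sum, sum_mul_sum]
    refine sum_congr rfl fun m _ => sum_congr rfl fun n _ => ?_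
    rw [star_mul', star_prod, prod_mul_distrib]
    simp only [star_pow]
    ring
  have hint (m n : Fin d ⊕ Fin d →₀ ℕ) : Integrable (fun ψ : PureState (Fin d) =>
      coeff m p * star (coeff n p) *
        ∏ i, ψ.1 i ^ m (Sum.inr i) * star (ψ.1 i) ^ n (Sum.inr i)) (haarState d) :=
    integrable_haarState (by fun_prop)
  have key : ((∫ ψ, ‖evalAt p ψ‖ ^ 2 ∂haarState d : ℝ) : ℂ) =
      ((normSq p / d.ascFactorial s : ℝ) : ℂ) := by
    rw [← integral_complex_ofReal]
    simp only [hsq]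
    rw [integral_finsetSum _ fun m _ => integrable_finsetSum _ fun n _ => hint m n]
    rw [normSq, sum_div, Complex.ofReal_sum]
    refine sum_congr rfl fun m hm => ?_
    rw [integral_finsetSum _ fun n _ => hint m n, sum_eq_single_of_mem m hm]
    · rw [integral_const_mul, integral_monomial_haarState d s _ _ (hp.sum_exponent hm).2
        (hp.sum_exponent hm).2, if_pos rfl, RCLike.star_def, Complex.mul_conj', weight_eq_prod,
        Fintype.prod_sum_type]
      simp only [hl m hm]
      push_cast
      simp
      ring
    · intro n hn hne
      rw [integral_const_mul, integral_monomial_haarState d s _ _ (hp.sum_exponent hm).2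
        (hp.sum_exponent hn).2, if_neg, mul_zero]
      intro h
      refine hne (Finsupp.ext fun x => ?_)
      cases x with
      | inl i => rw [hl m hm, hl n hn]
      | inr i => exact (congrFun h i).symm
  exact_mod_cast key

/-- Euler's identity and Cauchy–Schwarz on the unit sphere bound `(r + 1) ^ 2 * |p| ^ 2` by the
squared `z`-gradient, whose total `normSq` is `(r + 1) * normSq p`. This removes one `z`-degree at a
time, down to polynomials in `ψ` alone, where the moments give equality. -/
theorem Bihomogeneous.integral_sq_evalAt_le {p : MvPolynomial (Fin d ⊕ Fin d) ℂ} {r s : ℕ}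
    (hp : Bihomogeneous p r s) :
    ∫ ψ, ‖evalAt p ψ‖ ^ 2 ∂haarState d ≤ normSq p / (r ! * d.ascFactorial s) := by
  induction r generalizing p with
  | zero => rw [hp.integral_sq_evalAt_zero]; simp
  | succ r ih =>
    have hr : (0 : ℝ) < r + 1 := by positivity
    have hpt (ψ : PureState (Fin d)) : ((r : ℝ) + 1) ^ 2 * ‖evalAt p ψ‖ ^ 2 ≤
        ∑ i, ‖evalAt (pderiv (Sum.inl i) p) ψ‖ ^ 2 := by
      have h1 : ((r + 1 : ℕ) : ℂ) * evalAt p ψ =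
          ∑ i, star (ψ.1 i) * evalAt (pderiv (Sum.inl i) p) ψ := by
        rw [← evalAt_smul, ← hp.euler_inl]
        simp [evalAt]
      have h2 : ((r : ℝ) + 1) * ‖evalAt p ψ‖ ≤
          ∑ i, ‖ψ.1 i‖ * ‖evalAt (pderiv (Sum.inl i) p) ψ‖ := by
        have h := norm_sum_le univ fun i => star (ψ.1 i) * evalAt (pderiv (Sum.inl i) p) ψ
        rw [← h1, norm_mul, Complex.norm_natCast] at h
        simpa only [norm_mul, norm_star, Nat.cast_add_one] using h
      rw [← mul_pow]
      refine (pow_le_pow_left₀ (by positivity) h2 2).trans ?_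
      refine (sum_mul_sq_le_sq_mul_sq _ _ _).trans_eq ?_
      rw [sum_normSq ψ, one_mul]
    have hi := integral_mono (μ := haarState d)
      (integrable_haarState (by have := continuous_evalAt p; fun_prop))
      (integrable_haarState (by
        have := fun i => continuous_evalAt (pderiv (Sum.inl i) p); fun_prop)) hpt
    rw [integral_const_mul, integral_finsetSum _ fun i _ => integrable_haarState (by
      have := continuous_evalAt (pderiv (Sum.inl i) p); fun_prop)] at hi
    have h3 := hi.trans (sum_le_sum fun i _ => ih (hp.pderiv_inl i))
    rw [← sum_div, hp.sum_normSq_pderiv_inl] at h3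
    have hD : (0 : ℝ) < d.ascFactorial s := by exact_mod_cast ascFactorial_pos_of_neZero d s
    have hf : (0 : ℝ) < r ! := by positivity
    rw [le_div_iff₀ (by positivity)] at h3 ⊢
    rw [Nat.factorial_succ]
    push_cast at h3 ⊢
    refine le_of_mul_le_mul_left ?_ hr
    linarith

/-- Raising `k` times before applying the general bound. Each raise gains the factor `r * (d + r +
1) / ((r + 1) * (d + r))` at the current degree `r`, and the product telescopes. -/
theorem Bihomogeneous.integral_sq_evalAt_le_of_form_eq_zero
    {p : MvPolynomial (Fin d ⊕ Fin d) ℂ} {r : ℕ} (hr : 0 < r) (k : ℕ) (hp : Bihomogeneous p r r)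
    (h : form (quadPow (Fin d) r) p = 0) :
    ∫ ψ, ‖evalAt p ψ‖ ^ 2 ∂haarState d ≤
      (r * (d + (r + k))) / ((r + k) * (d + r)) * (normSq p / (r ! * d.ascFactorial r)) := by
  have hd : (0 : ℝ) < d := by exact_mod_cast Nat.pos_of_neZero d
  have hr' : (0 : ℝ) < r := by exact_mod_cast hr
  induction k generalizing p r with
  | zero =>
    refine hp.integral_sq_evalAt_le.trans_eq ?_
    push_cast
    rw [add_zero, div_self (by positivity), one_mul]
  | succ k ih =>
    have h1 := ih (Nat.succ_pos r) hp.raise (form_quadPow_raise h) (by positivity)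
    simp only [evalAt_raise] at h1
    refine h1.trans ?_
    have h2 := hp.normSq_raise_le hr h
    rw [Fintype.card_fin] at h2
    have hD : (0 : ℝ) < d.ascFactorial r := by exact_mod_cast ascFactorial_pos_of_neZero d r
    have hf : (0 : ℝ) < r ! := by positivity
    rw [Nat.factorial_succ, Nat.ascFactorial_succ]
    push_cast
    calc _ ≤ ((r + 1) * (d + (r + 1 + k))) / ((r + 1 + k) * (d + (r + 1))) *
        ((r * (d + r + 1) * normSq p) / ((r + 1) * r ! * ((d + r) * d.ascFactorial r)) : ℝ) := by
          gcongr
      _ = _ := by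
          field_simp
          ring

theorem Bihomogeneous.integral_sq_evalAt_le_two
    {p : MvPolynomial (Fin d ⊕ Fin d) ℂ} {r : ℕ} (hr : 0 < r) (hp : Bihomogeneous p r r)
    (h : form (quadPow (Fin d) r) p = 0) :
    ∫ ψ, ‖evalAt p ψ‖ ^ 2 ∂haarState d ≤
      2 * r / d * (normSq p / (r ! * d.ascFactorial r)) := by
  have hd : (0 : ℝ) < d := by exact_mod_cast Nat.pos_of_neZero d
  have hr' : (0 : ℝ) < r := by exact_mod_cast hr
  -- Taking `k = d` already gives the order `r / d`; the limit `k → ∞` would give `r / (d + r)`.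
  refine (hp.integral_sq_evalAt_le_of_form_eq_zero hr d h).trans ?_
  have := normSq_nonneg p
  gcongr ?_ * _
  rw [div_le_div_iff₀ (by positivity) hd]
  nlinarith [mul_pos hr' hd, mul_pos hr' hr', mul_pos hd hd, mul_pos (mul_pos hr' hd) hd, mul_pos (mul_pos hr' hr') hd, mul_pos (mul_pos hr' hr') hr']

end Haar

end Fischer

namespace Fischer

open MvPolynomial Finset SSI
open scoped Nat

/-! ### Expectations in `ψ^{⊗t}` as polynomials, and their deviation from constants. -/

section Tensors

variable {ι : Type*} {t r s : ℕ}

/-- The monomial `∏ k, z (x k)`. -/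
noncomputable def zMonomial (x : Fin t → ι) : MvPolynomial (ι ⊕ ι) ℂ := ∏ k, X (Sum.inl (x k))

/-- The monomial `∏ k, w (y k)`. -/
noncomputable def wMonomial (y : Fin t → ι) : MvPolynomial (ι ⊕ ι) ℂ := ∏ k, X (Sum.inr (y k))

theorem bihomogeneous_wMonomial (y : Fin t → ι) : Bihomogeneous (wMonomial y) 0 t := by
  induction t with
  | zero => simpa [wMonomial] using Bihomogeneous.one
  | succ t ih =>
    rw [wMonomial, Fin.prod_univ_succ]
    exact (ih (Fin.tail y)).X_inr_mul _

variable [Fintype ι]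

theorem sum_cons {M : Type*} [AddCommMonoid M] (f : (Fin (t + 1) → ι) → M) :
    ∑ x, f x = ∑ i, ∑ x, f (Fin.cons i x) := by
  rw [← Fintype.sum_prod_type']
  exact (Fintype.sum_equiv (Fin.consEquiv fun _ => ι) _ _ fun _ => rfl).symm

theorem bihomogeneous_sum_zMonomial_mul {Q : (Fin r → ι) → MvPolynomial (ι ⊕ ι) ℂ}
    (hQ : ∀ x, Bihomogeneous (Q x) 0 s) : Bihomogeneous (∑ x, zMonomial x * Q x) r s := by
  induction r with
  | zero => simpa [zMonomial] using hQ _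
  | succ r ih =>
    simp only [sum_cons, zMonomial, Fin.prod_univ_succ, Fin.cons_zero, Fin.cons_succ, mul_assoc,
      ← mul_sum]
    exact Bihomogeneous.sum _ fun i => (ih fun x => hQ (Fin.cons i x)).X_inl_mul i

theorem normSq_sum_zMonomial_mul_le {Q : (Fin r → ι) → MvPolynomial (ι ⊕ ι) ℂ}
    (hQ : ∀ x, Bihomogeneous (Q x) 0 s) :
    normSq (∑ x, zMonomial x * Q x) ≤ r ! * ∑ x, normSq (Q x) := by
  induction r with
  | zero => simp [zMonomial]
  | succ r ih =>
    simp only [sum_cons, zMonomial, Fin.prod_univ_succ, Fin.cons_zero, Fin.cons_succ, mul_assoc,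
      ← mul_sum]
    refine (Bihomogeneous.normSq_sum_X_inl_mul_le fun i =>
      bihomogeneous_sum_zMonomial_mul fun x => hQ (Fin.cons i x)).trans ?_
    rw [Nat.factorial_succ, Nat.cast_mul, mul_assoc, Nat.cast_add_one]
    refine mul_le_mul_of_nonneg_left ?_ (by positivity)
    rw [mul_sum]
    exact sum_le_sum fun i _ => ih fun x => hQ (Fin.cons i x)

theorem sum_normSq_wMonomial :
    ∑ y : Fin t → ι, normSq (wMonomial y) = (Fintype.card ι).ascFactorial t := by
  induction t with
  | zero =>
    have h : ((normSq (1 : MvPolynomial (ι ⊕ ι) ℂ) : ℝ) : ℂ) = (1 : ℝ) := by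
      rw [← form_self, form_eq_sum (s := {0}) (by rw [← C_1]; exact support_monomial_subset)]
      simp [weight]
    simpa [wMonomial] using h
  | succ t ih =>
    rw [sum_cons, sum_comm]
    simp only [wMonomial, Fin.prod_univ_succ, Fin.cons_zero, Fin.cons_succ]
    rw [Nat.ascFactorial_succ, Nat.cast_mul, ← ih, mul_sum, Nat.cast_add]
    exact sum_congr rfl fun y _ => (bihomogeneous_wMonomial y).sum_normSq_X_inr_mul

/-- The bihomogeneous polynomial `∑ x y, a x y * ∏ k, z (x k) * ∏ k, w (y k)`. -/
noncomputable def kernelPoly (a : (Fin t → ι) → (Fin t → ι) → ℂ) : MvPolynomial (ι ⊕ ι) ℂ :=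
  ∑ x, zMonomial x * ∑ y, a x y • wMonomial y

theorem bihomogeneous_kernelPoly (a : (Fin t → ι) → (Fin t → ι) → ℂ) :
    Bihomogeneous (kernelPoly a) t t :=
  bihomogeneous_sum_zMonomial_mul fun _ =>
    Bihomogeneous.sum _ fun y => (bihomogeneous_wMonomial y).smul _

/-- Multiplication by the `z`-monomials costs `t!`, the contraction `a` costs nothing, and the
`w`-monomials contribute `d.ascFactorial t`. The product is exactly the denominator in the mean
square bound. -/
theorem sum_normSq_kernelPoly_le {J : Type*} [Fintype J]
    (a : J → (Fin t → ι) → (Fin t → ι) → ℂ)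
    (ha : ∀ e : (Fin t → ι) → ℂ, ∑ j, ∑ x, ‖∑ y, a j x y * e y‖ ^ 2 ≤ ∑ y, ‖e y‖ ^ 2) :
    ∑ j, normSq (kernelPoly (a j)) ≤ t ! * (Fintype.card ι).ascFactorial t := by
  refine (sum_le_sum fun j _ => normSq_sum_zMonomial_mul_le fun x =>
    Bihomogeneous.sum _ fun y => (bihomogeneous_wMonomial y).smul (a j x y)).trans ?_
  rw [← mul_sum, ← sum_normSq_wMonomial, ← Fintype.sum_prod_type']
  refine mul_le_mul_of_nonneg_left ?_ (by positivity)
  exact normSq_sum_contraction (fun jx : J × (Fin t → ι) => a jx.1 jx.2)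
    (fun e => by simpa only [Fintype.sum_prod_type] using ha e) _

/-- The number `⟨ψ^{⊗ t}| a |ψ^{⊗ t}⟩`. -/
noncomputable def sandwich (a : (Fin t → ι) → (Fin t → ι) → ℂ) (ψ : PureState ι) : ℂ :=
  ∑ x, ∑ y, star ((tensorPower t ψ).1 x) * a x y * (tensorPower t ψ).1 y

theorem evalAt_kernelPoly (a : (Fin t → ι) → (Fin t → ι) → ℂ) (ψ : PureState ι) :
    evalAt (kernelPoly a) ψ = sandwich a ψ := by
  simp only [evalAt, kernelPoly, zMonomial, wMonomial, sandwich, tensorPower, map_sum, map_mul,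
    map_prod, eval_X, smul_eval, Sum.elim_inl, Sum.elim_inr, mul_sum, star_prod, mul_assoc]

theorem continuous_sandwich (a : (Fin t → ι) → (Fin t → ι) → ℂ) : Continuous (sandwich a) := by
  have h := continuous_evalAt (kernelPoly a)
  rwa [funext (evalAt_kernelPoly a)] at h

theorem normSq_quadPow_pos [Nonempty ι] (k : ℕ) : 0 < normSq (quadPow ι k) := by
  classical
  refine (normSq_nonneg _).lt_of_ne fun h => ?_
  have h0 : quadPow ι k = 0 := by
    ext m
    rw [normSq, eq_comm, sum_eq_zero_iff_of_nonneg fun m _ =>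
      mul_nonneg (weight_pos m).le (sq_nonneg _)] at h
    by_contra hm
    have := h m (mem_support_iff.mpr hm)
    rw [mul_eq_zero, or_iff_right (weight_pos m).ne', sq_eq_zero_iff, norm_eq_zero] at this
    exact hm this
  obtain ⟨i⟩ := ‹Nonempty ι›
  have h1 := evalAt_quadPow k (⟨EuclideanSpace.single i 1, by simp⟩ : PureState ι)
  simp [h0, evalAt] at h1

theorem exists_form_sub_smul_quadPow_eq_zero [Nonempty ι] (p : MvPolynomial (ι ⊕ ι) ℂ) (k : ℕ) :
    ∃ m : ℂ, form (quadPow ι k) (p + (-m) • quadPow ι k) = 0 ∧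
      normSq (p + (-m) • quadPow ι k) ≤ normSq p := by
  have hpos := normSq_quadPow_pos (ι := ι) k
  have hne : ((normSq (quadPow ι k) : ℝ) : ℂ) ≠ 0 := by exact_mod_cast hpos.ne'
  set m : ℂ := form (quadPow ι k) p / normSq (quadPow ι k) with hm
  have h0 : form (quadPow ι k) (p + (-m) • quadPow ι k) = 0 := by
    rw [form_add_right, form_smul_right, form_self, hm]
    field_simp
    ring
  refine ⟨m, h0, ?_⟩
  set q := p + (-m) • quadPow ι k with hq
  have hp : p = q + m • quadPow ι k := by rw [hq]; module
  have h1 : ((normSq p : ℝ) : ℂ) =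
      ((normSq q + ‖m‖ ^ 2 * normSq (quadPow ι k) : ℝ) : ℂ) := by
    rw [← normSq_smul, Complex.ofReal_add, ← form_self, ← form_self, ← form_self]
    conv_lhs => rw [hp]
    have h2 : form q (quadPow ι k) = 0 := by rw [← star_form, h0, star_zero]
    simp only [form_add_left, form_add_right, form_smul_left, form_smul_right, h0, h2]
    ring
  have h3 : normSq p = normSq q + ‖m‖ ^ 2 * normSq (quadPow ι k) := by exact_mod_cast h1
  have := mul_nonneg (sq_nonneg ‖m‖) hpos.le
  linarith

end Tensors

attribute [local instance] isProbabilityMeasure_haarState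

theorem exists_integral_sq_sandwich_sub_le {d : ℕ} [NeZero d] {t : ℕ} {J : Type*} [Fintype J]
    (a : J → (Fin t → Fin d) → (Fin t → Fin d) → ℂ)
    (ha : ∀ e : (Fin t → Fin d) → ℂ, ∑ j, ∑ x, ‖∑ y, a j x y * e y‖ ^ 2 ≤ ∑ y, ‖e y‖ ^ 2) :
    ∃ m : J → ℂ, ∫ ψ, ∑ j, ‖sandwich (a j) ψ - m j‖ ^ 2 ∂haarState d ≤ 2 * t / d := by
  -- With no copies the sandwich is a constant, so it serves as its own centre.
  rcases Nat.eq_zero_or_pos t with rfl | ht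
  · exact ⟨fun j => ∑ x, ∑ y, a j x y, by simp [sandwich, tensorPower]⟩
  choose m hm0 hm using fun j =>
    exists_form_sub_smul_quadPow_eq_zero (kernelPoly (a j)) t
  refine ⟨m, ?_⟩
  have hq (j : J) : Bihomogeneous (kernelPoly (a j) + (-m j) • quadPow (Fin d) t) t t :=
    (bihomogeneous_kernelPoly _).add ((bihomogeneous_quadPow t).smul _)
  have he (j : J) (ψ : PureState (Fin d)) : sandwich (a j) ψ - m j =
      evalAt (kernelPoly (a j) + (-m j) • quadPow (Fin d) t) ψ := by
    rw [evalAt_add, evalAt_smul, evalAt_quadPow, evalAt_kernelPoly]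
    ring
  simp only [he]
  rw [integral_finsetSum _ fun j _ => integrable_haarState (by
    have := continuous_evalAt (kernelPoly (a j) + (-m j) • quadPow (Fin d) t); fun_prop)]
  refine (sum_le_sum fun j _ => (hq j).integral_sq_evalAt_le_two ht (hm0 j)).trans ?_
  rw [← mul_sum, ← sum_div]
  refine mul_le_of_le_one_right (by positivity) (div_le_one_of_le₀ ?_ (by positivity))
  have h := sum_normSq_kernelPoly_le a ha
  rw [Fintype.card_fin] at h
  exact (sum_le_sum fun j _ => hm j).trans h

end Fischer

/-! ### Separating Bob from Charlie. -/

namespace Fischer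

open Finset SSI

open scoped MatrixOrder in
theorem exists_eq_conjTranspose_mul_self {n : Type*} [Fintype n] {M : Matrix n n ℂ}
    (hM : M.PosSemidef) : ∃ D : Matrix n n ℂ, M = Dᴴ * D := by
  classical
  exact CStarAlgebra.nonneg_iff_eq_star_mul_self.mp hM.nonneg

theorem sum_sq_mulVec_le {n : Type*} [Fintype n] [DecidableEq n] {M : Matrix n n ℂ}
    (hM : M.PosSemidef) (hM' : (1 - M).PosSemidef) (v : n → ℂ) :
    ∑ i, ‖∑ j, M i j * v j‖ ^ 2 ≤ ∑ i, ‖v i‖ ^ 2 := by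
  have h1 : (1 - Mᴴ * M).PosSemidef := by
    -- `1 - M² = (1 - M) + M (1 - M) M + (1 - M) M (1 - M)`, a sum of positive terms.
    have h := (hM'.add (hM'.conjTranspose_mul_mul_same M)).add (hM.conjTranspose_mul_mul_same (1 - M))
    have e : 1 - M + Mᴴ * (1 - M) * M + (1 - M)ᴴ * M * (1 - M) = 1 - Mᴴ * M := by
      rw [hM.isHermitian.eq, hM'.isHermitian.eq]
      noncomm_ring
    rwa [e] at h
  have hsq (w : n → ℂ) : star w ⬝ᵥ w = ((∑ i, ‖w i‖ ^ 2 : ℝ) : ℂ) := by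
    simp only [dotProduct, Pi.star_apply, RCLike.star_def, Complex.conj_mul']
    push_cast
    rfl
  have h2 := h1.dotProduct_mulVec_nonneg v
  rw [Matrix.sub_mulVec, Matrix.one_mulVec, dotProduct_sub, ← Matrix.mulVec_mulVec,
    Matrix.dotProduct_mulVec, ← Matrix.star_mulVec, hsq, hsq, ← Complex.ofReal_sub,
    Complex.zero_le_real, sub_nonneg] at h2
  exact h2

section Adversary

variable {B C X Y : Type*} [Fintype B] [Fintype C] [Fintype X] [Fintype Y]

variable {K : Type*} [Fintype K] {D : Matrix K (B × C) ℂ}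

/-- Bob's measurement, applied to the columns of a square root of the shared state. -/
def bobKernel (M : Matrix (B × X) (B × X) ℂ) (D : Matrix K (B × C) ℂ) (j : (K × B) × C)
    (x y : X) : ℂ :=
  ∑ b, M (j.1.2, x) (b, y) * star (D j.1.1 (b, j.2))

/-- Charlie's measurement, applied to the columns of a square root of the shared state. -/
def charlieKernel (N : Matrix (C × Y) (C × Y) ℂ) (D : Matrix K (B × C) ℂ) (j : (K × B) × C)
    (x y : Y) : ℂ :=
  ∑ c, N (j.2, x) (c, y) * star (D j.1.1 (j.1.2, c))

/-- For each `k` and `c`, the contraction `M` acts on `conj (D k (·, c)) ⊗ e`; the squared norms of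
these vectors sum to `‖e‖²` because the shared state has trace one. -/
theorem bobKernel_contraction [DecidableEq B] [DecidableEq X] {M : Matrix (B × X) (B × X) ℂ} (hM : M.PosSemidef)
    (hM' : (1 - M).PosSemidef) (hD : ∑ k, ∑ b, ∑ c, ‖D k (b, c)‖ ^ 2 = 1) (e : X → ℂ) :
    ∑ j, ∑ x, ‖∑ y, bobKernel M D j x y * e y‖ ^ 2 ≤ ∑ y, ‖e y‖ ^ 2 := by
  have h (k : K) (c : C) := sum_sq_mulVec_le hM hM' fun p => star (D k (p.1, c)) * e p.2
  simp only [Fintype.sum_prod_type, norm_mul, norm_star, mul_pow, ← mul_sum, ← sum_mul] at h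
  have h2 := sum_le_sum fun k (_ : k ∈ univ) => sum_le_sum fun c (_ : c ∈ univ) => h k c
  simp only [← sum_mul] at h2
  have hD' : ∑ k, ∑ c, ∑ b, ‖D k (b, c)‖ ^ 2 = 1 := by
    rw [← hD]
    exact sum_congr rfl fun k _ => sum_comm
  rw [hD', one_mul] at h2
  refine le_of_eq_of_le ?_ h2
  simp only [Fintype.sum_prod_type]
  refine sum_congr rfl fun k _ => ?_
  rw [sum_comm]
  refine sum_congr rfl fun c _ => sum_congr rfl fun b _ => sum_congr rfl fun x _ => ?_
  simp only [bobKernel, sum_mul]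
  rw [sum_comm]
  simp only [mul_assoc]

theorem charlieKernel_contraction [DecidableEq C] [DecidableEq Y]
    {N : Matrix (C × Y) (C × Y) ℂ} (hN : N.PosSemidef)
    (hN' : (1 - N).PosSemidef) (hD : ∑ k, ∑ b, ∑ c, ‖D k (b, c)‖ ^ 2 = 1) (e : Y → ℂ) :
    ∑ j, ∑ x, ‖∑ y, charlieKernel N D j x y * e y‖ ^ 2 ≤ ∑ y, ‖e y‖ ^ 2 := by
  have h (k : K) (b : B) := sum_sq_mulVec_le hN hN' fun p => star (D k (b, p.1)) * e p.2
  simp only [Fintype.sum_prod_type, norm_mul, norm_star, mul_pow, ← mul_sum, ← sum_mul] at h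
  have h2 := sum_le_sum fun k (_ : k ∈ univ) => sum_le_sum fun b (_ : b ∈ univ) => h k b
  simp only [← sum_mul] at h2
  rw [hD, one_mul] at h2
  refine le_of_eq_of_le ?_ h2
  simp only [Fintype.sum_prod_type]
  refine sum_congr rfl fun k _ => sum_congr rfl fun b _ => sum_congr rfl fun c _ =>
    sum_congr rfl fun x _ => ?_
  simp only [charlieKernel, sum_mul]
  rw [sum_comm]
  simp only [mul_assoc]

variable [DecidableEq B] [DecidableEq C] [DecidableEq X] [DecidableEq Y]

theorem continuous_outputProb (A : NonlocalAdversary B C X Y) (b₁ b₂ : Bool) :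
    Continuous fun ψ : PureState (X × Y) => A.outputProb ψ b₁ b₂ := by
  simp only [NonlocalAdversary.outputProb, Matrix.trace, Matrix.diag, Matrix.mul_apply,
    NonlocalAdversary.globalState, Matrix.reindex_apply, Matrix.submatrix_apply,
    Matrix.kroneckerMap_apply, densityMatrix, Matrix.vecMulVec_apply]
  fun_prop

/-- `Tr ((M ⊗ N) Dᴴ D)` is the Hilbert–Schmidt product of `(M ⊗ 1) Dᴴ` and `(1 ⊗ N) Dᴴ`, as `M` is
Hermitian. The index `j` collects the row of `D` and the outgoing indices of `B` and `C`. -/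
theorem outputProb_tensor (A : NonlocalAdversary B C X Y) (hD : A.shared = Dᴴ * D)
    (u : PureState X) (v : PureState Y) (b₁ b₂ : Bool) :
    A.outputProb (tensor u v) b₁ b₂ = (∑ j,
      star (∑ x, ∑ y, star (u.1 x) * bobKernel (A.bob b₁) D j x y * u.1 y) *
      ∑ x, ∑ y, star (v.1 x) * charlieKernel (A.charlie b₂) D j x y * v.1 y).re := by
  have hM (p q : B × X) : star (A.bob b₁ p q) = A.bob b₁ q p := by
    conv_rhs => rw [← (A.bob_posSemidef b₁).isHermitian.eq]
    rfl
  rw [NonlocalAdversary.outputProb]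
  congr 1
  simp only [Matrix.trace, Matrix.diag, Matrix.mul_apply, NonlocalAdversary.globalState,
    Matrix.reindex_apply, Matrix.submatrix_apply, Matrix.kroneckerMap_apply, densityMatrix,
    Matrix.vecMulVec_apply, hD, Matrix.conjTranspose_apply, Fintype.sum_prod_type, bobKernel,
    charlieKernel, star_sum, mul_sum, sum_mul, star_mul', star_star, hM]
  simp only [← Fintype.sum_prod_type']
  refine Fintype.sum_equiv
    ⟨fun ⟨b', x', c', y', b, x, c, y, k⟩ => ⟨k, b, c', y', y, c, x, x', b'⟩,
      fun ⟨k, b, c', y', y, c, x, x', b'⟩ => ⟨b', x', c', y', b, x, c, y, k⟩,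
      fun _ => rfl, fun _ => rfl⟩ _ _ fun ⟨b', x', c', y', b, x, c, y, k⟩ => ?_
  simp only [Equiv.coe_fn_mk, Equiv.prodProdProdComm_symm, Equiv.prodProdProdComm_apply, tensor,
    star_mul']
  ring

end Adversary

-- Identical versus independent samples.

attribute [local instance] isProbabilityMeasure_haarState

theorem abs_integral_diag_sub_integral_prod_le {d : ℕ} [NeZero d] {J : Type*} [Fintype J]
    {F G : J → PureState (Fin d) → ℂ} (hF : ∀ j, Continuous (F j)) (hG : ∀ j, Continuous (G j))
    (m n : J → ℂ) {ε : ℝ}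
    (hFm : ∫ ψ, ∑ j, ‖F j ψ - m j‖ ^ 2 ∂haarState d ≤ ε)
    (hGn : ∫ ψ, ∑ j, ‖G j ψ - n j‖ ^ 2 ∂haarState d ≤ ε) :
    |∫ ψ, (∑ j, star (F j ψ) * G j ψ).re ∂haarState d -
      ∫ p, (∑ j, star (F j p.1) * G j p.2).re ∂(haarState d).prod (haarState d)| ≤ 2 * ε := by
  set μ := haarState d
  let g : PureState (Fin d) → PureState (Fin d) → ℝ :=
    fun ψ φ => (∑ j, star (F j ψ - m j) * (G j φ - n j)).re
  let a : PureState (Fin d) → ℝ := fun ψ => (∑ j, star (F j ψ - m j) * n j).re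
  let b : PureState (Fin d) → ℝ := fun φ => (∑ j, star (m j) * G j φ).re
  let U : PureState (Fin d) → ℝ := fun ψ => ∑ j, ‖F j ψ - m j‖ ^ 2
  let V : PureState (Fin d) → ℝ := fun ψ => ∑ j, ‖G j ψ - n j‖ ^ 2
  -- Only the doubly centred part `g` couples the two samples; `a` and `b` see just the marginals,
  -- which agree under both laws.
  have hdec (ψ φ : PureState (Fin d)) :
      (∑ j, star (F j ψ) * G j φ).re = g ψ φ + (a ψ + b φ) := by
    simp only [g, a, b, ← Complex.add_re, ← sum_add_distrib]
    congr 1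
    refine sum_congr rfl fun j _ => ?_
    rw [star_sub]
    ring
  have hgle (ψ φ : PureState (Fin d)) : ‖g ψ φ‖ ≤ (U ψ + V φ) / 2 := by
    refine (Complex.abs_re_le_norm _).trans ((norm_sum_le _ _).trans ?_)
    simp only [U, V, ← sum_add_distrib, sum_div]
    refine sum_le_sum fun j _ => ?_
    rw [norm_mul, norm_star]
    linarith [two_mul_le_add_sq ‖F j ψ - m j‖ ‖G j φ - n j‖]
  have hint {f : PureState (Fin d) × PureState (Fin d) → ℝ} (hf : Continuous f) :
      Integrable f (μ.prod μ) :=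
    hf.integrable_of_hasCompactSupport (HasCompactSupport.of_compactSpace f)
  have hU : Continuous U := by fun_prop
  have hV : Continuous V := by fun_prop
  have ha : Continuous a := by fun_prop
  have hb : Continuous b := by fun_prop
  have hg : Continuous fun p : PureState (Fin d) × PureState (Fin d) => g p.1 p.2 := by fun_prop
  have hgd : Continuous fun ψ : PureState (Fin d) => g ψ ψ := by fun_prop
  simp only [hdec]
  have e1 : ∫ ψ, g ψ ψ + (a ψ + b ψ) ∂μ = ∫ ψ, g ψ ψ ∂μ + (∫ ψ, a ψ ∂μ + ∫ ψ, b ψ ∂μ) := by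
    rw [integral_add (integrable_haarState hgd) (integrable_haarState (by fun_prop)),
      integral_add (integrable_haarState ha) (integrable_haarState hb)]
  have e2 : ∫ p, g p.1 p.2 + (a p.1 + b p.2) ∂μ.prod μ =
      ∫ p, g p.1 p.2 ∂μ.prod μ + (∫ ψ, a ψ ∂μ + ∫ ψ, b ψ ∂μ) := by
    rw [integral_add (hint hg) (hint (by fun_prop)), integral_add (hint (by fun_prop))
      (hint (by fun_prop)), integral_fun_fst, integral_fun_snd]
    simp
  have b1 : ‖∫ ψ, g ψ ψ ∂μ‖ ≤ ε := by
    refine (norm_integral_le_of_norm_le (integrable_haarState (by fun_prop))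
      (.of_forall fun ψ => hgle ψ ψ)).trans ?_
    rw [integral_div, integral_add (integrable_haarState hU) (integrable_haarState hV)]
    linarith
  have b2 : ‖∫ p, g p.1 p.2 ∂μ.prod μ‖ ≤ ε := by
    refine (norm_integral_le_of_norm_le (hint (by fun_prop))
      (.of_forall fun p => hgle p.1 p.2)).trans ?_
    rw [integral_div, integral_add (hint (by fun_prop)) (hint (by fun_prop)), integral_fun_fst,
      integral_fun_snd]
    simp only [probReal_univ, one_smul]
    linarith
  rw [e1, e2, add_sub_add_right_eq_sub, ← Real.norm_eq_abs]
  refine (norm_sub_le _ _).trans ?_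
  linarith

theorem holdsSSI_copies_haarState (d : ℕ) [NeZero d] (t : ℕ) {ε : ℝ} (hε : 4 * t / d ≤ ε) :
    HoldsSSI ε (copies t (haarState d)) := by
  intro B C _ _ _ _ A b₁ b₂
  obtain ⟨D, hD⟩ := exists_eq_conjTranspose_mul_self A.shared_posSemidef
  have hD1 : ∑ k, ∑ b, ∑ c, ‖D k (b, c)‖ ^ 2 = 1 := by
    have h := A.shared_trace
    rw [hD, Matrix.trace] at h
    simp only [Matrix.diag, Matrix.mul_apply, Matrix.conjTranspose_apply, RCLike.star_def,
      Complex.conj_mul'] at h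
    rw [sum_comm] at h
    have h' : ∑ k, ∑ p, ‖D k p‖ ^ 2 = 1 := by exact_mod_cast h
    rw [← h']
    exact sum_congr rfl fun k _ => (Fintype.sum_prod_type fun p => ‖D k p‖ ^ 2).symm
  have hbob : (1 - A.bob b₁).PosSemidef := by
    have h := A.bob_sum
    rw [Fintype.sum_bool] at h
    cases b₁
    · rw [← h, add_sub_cancel_right]; exact A.bob_posSemidef _
    · rw [← h, add_sub_cancel_left]; exact A.bob_posSemidef _
  have hcharlie : (1 - A.charlie b₂).PosSemidef := by
    have h := A.charlie_sum
    rw [Fintype.sum_bool] at h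
    cases b₂
    · rw [← h, add_sub_cancel_right]; exact A.charlie_posSemidef _
    · rw [← h, add_sub_cancel_left]; exact A.charlie_posSemidef _
  obtain ⟨m, hm⟩ := exists_integral_sq_sandwich_sub_le (bobKernel (A.bob b₁) D)
    (bobKernel_contraction (A.bob_posSemidef b₁) hbob hD1)
  obtain ⟨n, hn⟩ := exists_integral_sq_sandwich_sub_le (charlieKernel (A.charlie b₂) D)
    (charlieKernel_contraction (A.charlie_posSemidef b₂) hcharlie hD1)
  have hmt := measurable_tensorPower (ι := Fin d) t
  have hcont := continuous_outputProb A b₁ b₂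
  have hid : ∫ ψ, A.outputProb ψ b₁ b₂ ∂identical (copies t (haarState d)) =
      ∫ ψ, A.outputProb (tensor (tensorPower t ψ) (tensorPower t ψ)) b₁ b₂ ∂haarState d := by
    rw [identical, copies, integral_map (by
      exact (measurable_tensor.comp (measurable_id.prodMk measurable_id)).aemeasurable)
      hcont.aestronglyMeasurable, integral_map hmt.aemeasurable]
    exact (hcont.measurable.comp (measurable_tensor.comp
      (measurable_id.prodMk measurable_id))).aestronglyMeasurable
  have hind : ∫ ψ, A.outputProb ψ b₁ b₂ ∂independent (copies t (haarState d)) =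
      ∫ p, A.outputProb (tensor (tensorPower t p.1) (tensorPower t p.2)) b₁ b₂
        ∂(haarState d).prod (haarState d) := by
    rw [independent, copies, Measure.map_prod_map _ _ hmt hmt,
      integral_map measurable_tensor.aemeasurable hcont.aestronglyMeasurable,
      integral_map (hmt.prodMap hmt).aemeasurable]
    · rfl
    · exact (hcont.measurable.comp measurable_tensor).aestronglyMeasurable
  rw [hid, hind]
  simp only [outputProb_tensor A hD]
  refine (abs_integral_diag_sub_integral_prod_le (fun j => continuous_sandwich _)
    (fun j => continuous_sandwich _) m n hm hn).trans (le_trans (le_of_eq ?_) hε)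
  ring

end Fischer

theorem mainTheorem1 :
    (∃ K : ℝ, 0 < K ∧ ∀ n t : ℕ,
      SSI.HoldsSSI (K * ((t : ℝ) ^ 2 / Real.sqrt ((2 : ℝ) ^ n)))
        (SSI.copies t (SSI.haarState (2 ^ n)))) ∧
    (∀ (ε : ℕ → ℝ) (t : ℕ → ℕ), Filter.Tendsto ε Filter.atTop (nhds 0) →
      (∀ n : ℕ, (t n : ℝ) = ε n * (2 : ℝ) ^ ((n : ℝ) / 4)) →
      ∃ δ : ℕ → ℝ, Asymptotics.IsBigO Filter.atTop δ (fun n => ε n ^ 2) ∧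
        ∀ n : ℕ, SSI.HoldsSSI (δ n) (SSI.copies (t n) (SSI.haarState (2 ^ n)))) := by
  have main (n t : ℕ) : SSI.HoldsSSI (4 * ((t : ℝ) ^ 2 / Real.sqrt ((2 : ℝ) ^ n)))
      (SSI.copies t (SSI.haarState (2 ^ n))) := by
    refine Fischer.holdsSSI_copies_haarState (2 ^ n) t ?_
    have h1 : (1 : ℝ) ≤ 2 ^ n := one_le_pow₀ one_le_two
    have h2 : Real.sqrt ((2 : ℝ) ^ n) ≤ 2 ^ n := (Real.sqrt_le_left (by positivity)).mpr (le_self_pow₀ h1 two_ne_zero)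
    have h3 : (t : ℝ) ≤ (t : ℝ) ^ 2 := by exact_mod_cast Nat.le_self_pow two_ne_zero t
    push_cast
    rw [mul_div_assoc]
    gcongr
  refine ⟨⟨4, four_pos, main⟩, fun ε t _ ht =>
    ⟨fun n => 4 * ε n ^ 2, (Asymptotics.isBigO_refl _ _).const_mul_left 4, fun n => ?_⟩⟩
  have h := main n (t n)
  -- With `t = ε * 2 ^ (n / 4)`, the ratio `t ^ 2 / √(2 ^ n)` is exactly `ε ^ 2`.
  have h2 : Real.sqrt ((2 : ℝ) ^ n) = ((2 : ℝ) ^ ((n : ℝ) / 4)) ^ 2 := by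
    rw [Real.sqrt_eq_rpow, ← Real.rpow_natCast, ← Real.rpow_mul two_pos.le, ← Real.rpow_natCast,
      ← Real.rpow_mul two_pos.le]
    congr 1
    push_cast
    ring
  rwa [ht n, h2, mul_pow, mul_div_cancel_right₀ _ (by positivity)] at h
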